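/- Let $\mathbb{D}$ be the open unit disc. For $p\ge 1$ and $\alpha\le 0$ let $X=l_a^p(\alpha)$ be the space of holomorphic functions $f=\sum_{k\ge 0}\hat f(k)z^k$ on $\mathbb{D}$ with $$\|f\|_X=\Big(\sum_{k\ge 0}|\hat f(k)|^p(k+1)^{p\alpha}\Big)^{1/p}<\infty,$$ and let $H^\infty$ be the space of bounded holomorphic functions on $\mathbb{D}$ with the norm $\|g\|_\infty=\sup_{z\in\mathbb{D}}|g(z)|$. For a finite sequence $\sigma=(\lambda_1,\dots,\lambda_m)$ in $\mathbb{D}$ (repetitions allowed), let $B_\sigma(z)=\prod_{j=1}^m\frac{\lambda_j-z}{1-\overline{\lambda_j}z}$ and $$c(\sigma,X,H^\infty)=\sup_{\|f\|_X\le 1}\inf\{\|g\|_\infty:\ g\in H^\infty,\ g-f\in B_\sigma X\}.$$ For an integer $n\ge 1$ and $r\in[0,1)$, let $C_{n,r}(X,H^\infty)$ be the supremum of $c(\sigma,X,H^\infty)$ over all $\sigma$ with at most $n$ terms (counted with multiplicity), all satisfying $|\lambda_j|\le r$. Theorem C. For every $p\in[1,2]$ and $\alpha\le 0$ there are constants $A,B>0$,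 depending only on $\alpha$ and $p$, such that for all integers $n\ge 1$ and all $r\in[0,1)$, $$B\,n^{1-\alpha-\frac1p}\ \le\ C_{n,r}\big(l_a^p(\alpha),H^\infty\big)\ \le\ A\Big(\frac{n}{1-r}\Big)^{\frac{1-2\alpha}{2}}.$$ -/

import Mathlib

open scoped ENNReal

noncomputable section

/-- The open unit disc of the complex plane. A function "on the disc" is represented by a function
`ℂ → ℂ`, of which only the values in the disc are ever used. -/
def disc : Set ℂ := Metric.ball (0 : ℂ) 1

/-- The `k`-th Taylor coefficient of `f` at the origin. -/
def taylorCoeff (f : ℂ → ℂ) (k : ℕ) : ℂ := iteratedDeriv k f 0 / (k.factorial : ℂ)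

/-- The (extended) norm `(∑ |f̂(k)|^p (k+1)^(pα))^(1/p)` of the space `l_a^p(α)`. -/
def laNorm (p α : ℝ) (f : ℂ → ℂ) : ℝ≥0∞ :=
  (∑' k : ℕ, ‖taylorCoeff f k‖ₑ ^ p * ((k : ℝ≥0∞) + 1) ^ (p * α)) ^ (1 / p)

/-- The (extended) supremum norm over the disc, the norm of `H^∞`. -/
def supNorm (g : ℂ → ℂ) : ℝ≥0∞ := ⨆ z ∈ disc, ‖g z‖ₑ

/-- The space of holomorphic functions on the disc for which an extended norm `N` is finite. -/
def holSpace (N : (ℂ → ℂ) → ℝ≥0∞) : Set (ℂ → ℂ) :=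
  {f | DifferentiableOn ℂ f disc ∧ N f < ∞}

/-- The finite Blaschke product `∏ (λ - z) / (1 - conj λ z)` over the points `λ` of `σ`, repeated
according to multiplicity. -/
def blaschke (σ : Multiset ℂ) (z : ℂ) : ℂ :=
  (σ.map fun a => (a - z) / (1 - (starRingEnd ℂ) a * z)).prod

/-- The set `B_σ X`, equality being that of functions on the disc. -/
def blaschkeMul (σ : Multiset ℂ) (X : Set (ℂ → ℂ)) : Set (ℂ → ℂ) :=
  {u | ∃ h ∈ X, ∀ z ∈ disc, u z = blaschke σ z * h z}

/-- The interpolation constant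
`c(σ, X, Y) = sup_{‖f‖_X ≤ 1} inf {‖g‖_Y : g ∈ Y, g - f ∈ B_σ X}`, where `X` and `Y` are the spaces
of holomorphic functions on the disc with norms `NX` and `NY`. -/
def interpConst (σ : Multiset ℂ) (NX NY : (ℂ → ℂ) → ℝ≥0∞) : ℝ≥0∞ :=
  ⨆ f ∈ {f | f ∈ holSpace NX ∧ NX f ≤ 1},
    ⨅ g ∈ {g | g ∈ holSpace NY ∧ g - f ∈ blaschkeMul σ (holSpace NX)}, NY g

/-- `C_{n,r}(X, Y)`: the supremum of `c(σ, X, Y)` over all `σ` with at most `n` points, counted with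
multiplicity, all of modulus at most `r`. -/
def interpConstSup (n : ℕ) (r : ℝ) (NX NY : (ℂ → ℂ) → ℝ≥0∞) : ℝ≥0∞ :=
  ⨆ σ ∈ {σ : Multiset ℂ | σ.card ≤ n ∧ ∀ a ∈ σ, ‖a‖ ≤ r}, interpConst σ NX NY

end

/-!
Lower bound. Take `σ = (0, …, 0)` with `n` terms, so that interpolating `f` means having the same
first `n` Taylor coefficients. For `f = n^(-1/p) ∑_{k < n} (k+1)^(-α) z^k`, of norm one, integrating
an interpolant `g` over circles against the Fejér kernel, which is positive of mean `n`, gives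
`∑_{j < n} ∑_{k ≤ j} f̂(k) ≤ n ‖g‖_∞` (`norm_sum_sum_coeff_le_of_bounded`), and the left side is of
order `n^(2 - α - 1/p)` (`le_sum_sum_rpow`).

Upper bound. Put `s = -α`, `M = n / (1 - r)`, `B = B_σ` and let `B*(w) = ∑ βⱼ wʲ` be the Blaschke
product of the conjugate points. The interpolant is `g = f - B h`, where `h` is the image of `f`
under the co-analytic Toeplitz operator with symbol the conjugate of `B`: its coefficients are
`∑ⱼ βⱼ f̂(m + j)`. As the `βⱼ` decrease geometrically, `h` is again in `l_a^p(α)`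
(`tsum_toeplitzCoeff_lt_top`), so only the bound for `g` in the disc is at stake. One has
`g(ζ) = ∑ₖ f̂(k) Qₖ(ζ)`, with
`∑ₖ Qₖ(ζ) wᵏ = (1 - B(ζ) B*(w)) / (1 - wζ)`.
The singularity at `w = 1/ζ` is removable since `B(ζ) B*(1/ζ) = 1`, so this series converges beyond
the circle of radius `ρ = 1 + 1/(4M)`, on which `|B*|` is at most `e` (`norm_blaschke_le`).
Parseval's identity on that circle, together with `∫ |1 - wζ|⁻² = 1 / (ρ²|ζ|² - 1)`, bounds
`∑ |Qₖ(ζ)|² ρ^(2k)` by a multiple of `M` once `|ζ|` is close to one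
(`exists_hasSum_norm_sq_kernelCoeff`). Since `(k+1)^s ≤ C M^s ρ^k` (`rpow_le_mul_pow`), and the unit
ball of `l_a^p(α)` lies in that of `l_a^2(α)` for `p ≤ 2`, the Cauchy-Schwarz inequality gives
`|g(ζ)| ≤ C' M^(s + 1/2)` near the unit circle, hence in the disc by the maximum principle.
-/

/-! ### Power series on the unit circle -/

/-- The point `exp (iθ)` of the unit circle. -/
noncomputable def circlePt (θ : ℝ) : ℂ := Complex.exp (θ * Complex.I)

lemma continuous_circlePt : Continuous circlePt := by unfold circlePt; fun_prop

lemma norm_circlePt (θ : ℝ) : ‖circlePt θ‖ = 1 := Complex.norm_exp_ofReal_mul_I θ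

lemma circlePt_ne_zero (θ : ℝ) : circlePt θ ≠ 0 := Complex.exp_ne_zero _

lemma conj_circlePt (θ : ℝ) : (starRingEnd ℂ) (circlePt θ) = (circlePt θ)⁻¹ := by
  rw [Complex.inv_def, Complex.normSq_eq_norm_sq, norm_circlePt]; simp

lemma circlePt_pow_mul_conj_pow (θ : ℝ) (j k : ℕ) :
    circlePt θ ^ j * (starRingEnd ℂ) (circlePt θ ^ k) =
      Complex.exp ((((j : ℤ) - k : ℤ) : ℂ) * Complex.I * θ) := by
  rw [map_pow, conj_circlePt, circlePt, ← Complex.exp_neg, ← Complex.exp_nat_mul,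
    ← Complex.exp_nat_mul, ← Complex.exp_add]
  congr 1
  push_cast
  ring

/-- Orthogonality of the characters `exp (ikθ)`. -/
lemma integral_circlePt_pow_mul_conj_pow (j k : ℕ) :
    ∫ θ in (0 : ℝ)..2 * Real.pi, circlePt θ ^ j * (starRingEnd ℂ) (circlePt θ ^ k) =
      if j = k then 2 * (Real.pi : ℂ) else 0 := by
  simp_rw [circlePt_pow_mul_conj_pow]
  split_ifs with h
  · simp [h]
  · have h' : ((j : ℤ) - k : ℤ) ≠ 0 := by omega
    rw [integral_exp_mul_complex (mul_ne_zero (Int.cast_ne_zero.2 h') Complex.I_ne_zero)]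
    have : Complex.exp ((((j : ℤ) - k : ℤ) : ℂ) * Complex.I * ((2 * Real.pi : ℝ) : ℂ)) = 1 := by
      rw [← Complex.exp_int_mul_two_pi_mul_I ((j : ℤ) - k)]
      congr 1
      push_cast
      ring
    rw [this]
    simp

section CircleSeries

variable {c : ℕ → ℂ} {F : ℝ → ℂ}

lemma continuous_of_hasSum_circlePt (hc : Summable fun k => ‖c k‖)
    (hF : ∀ θ, HasSum (fun k => c k * circlePt θ ^ k) (F θ)) : Continuous F := by
  have : F = fun θ => ∑' k, c k * circlePt θ ^ k := funext fun θ => (hF θ).tsum_eq.symm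
  rw [this]
  refine continuous_tsum (fun k => ?_) hc fun k θ => ?_
  · exact continuous_const.mul (continuous_circlePt.pow k)
  · simp [norm_circlePt]

/-- An absolutely convergent power series may be integrated termwise over the circle against a
continuous function. -/
lemma hasSum_integral_circlePt_mul (hc : Summable fun k => ‖c k‖)
    (hF : ∀ θ, HasSum (fun k => c k * circlePt θ ^ k) (F θ)) {G : ℝ → ℂ} (hG : Continuous G) :
    HasSum (fun k => c k * ∫ θ in (0 : ℝ)..2 * Real.pi, circlePt θ ^ k * G θ)
      (∫ θ in (0 : ℝ)..2 * Real.pi, F θ * G θ) := by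
  simp_rw [← intervalIntegral.integral_const_mul]
  refine intervalIntegral.hasSum_integral_of_dominated_convergence
    (fun k θ => ‖c k‖ * ‖G θ‖) (fun k => ?_) (fun k => ?_) ?_ ?_ ?_
  · exact (continuous_const.mul ((continuous_circlePt.pow k).mul hG)).aestronglyMeasurable
  · exact Filter.Eventually.of_forall fun θ _ => by simp [norm_circlePt]
  · exact Filter.Eventually.of_forall fun θ _ => hc.mul_right _
  · simp_rw [tsum_mul_right]
    exact (continuous_const.mul hG.norm).intervalIntegrable _ _
  · refine Filter.Eventually.of_forall fun θ _ => ?_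
    simpa [mul_assoc] using (hF θ).mul_right (G θ)

lemma integral_mul_circlePt_pow_mul_conj_pow (hc : Summable fun k => ‖c k‖)
    (hF : ∀ θ, HasSum (fun k => c k * circlePt θ ^ k) (F θ)) (i j : ℕ) :
    ∫ θ in (0 : ℝ)..2 * Real.pi,
        F θ * (circlePt θ ^ i * (starRingEnd ℂ) (circlePt θ ^ j)) =
      2 * Real.pi * if i ≤ j then c (j - i) else 0 := by
  have hG : Continuous fun θ => circlePt θ ^ i * (starRingEnd ℂ) (circlePt θ ^ j) :=
    (continuous_circlePt.pow i).mul (Complex.continuous_conj.comp (continuous_circlePt.pow j))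
  have h := hasSum_integral_circlePt_mul hc hF hG
  have h1 : ∀ k : ℕ, c k * ∫ θ in (0 : ℝ)..2 * Real.pi,
      circlePt θ ^ k * (circlePt θ ^ i * (starRingEnd ℂ) (circlePt θ ^ j)) =
      if k + i = j then 2 * Real.pi * c k else 0 := by
    intro k
    simp_rw [← mul_assoc, ← pow_add]
    rw [integral_circlePt_pow_mul_conj_pow]
    split_ifs <;> ring
  simp_rw [h1] at h
  rw [← h.tsum_eq]
  split_ifs with hij
  · rw [tsum_eq_single (j - i) fun k hk => if_neg (by omega), if_pos (by omega)]
  · rw [mul_zero]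
    exact (tsum_congr fun k => if_neg (by omega)).trans tsum_zero

/-- Parseval's identity for an absolutely convergent power series on the circle. -/
lemma hasSum_norm_sq_circlePt (hc : Summable fun k => ‖c k‖)
    (hF : ∀ θ, HasSum (fun k => c k * circlePt θ ^ k) (F θ)) :
    HasSum (fun k => ‖c k‖ ^ 2) ((2 * Real.pi)⁻¹ * ∫ θ in (0 : ℝ)..2 * Real.pi, ‖F θ‖ ^ 2) := by
  have hFc := continuous_of_hasSum_circlePt hc hF
  have h := hasSum_integral_circlePt_mul hc hF (Complex.continuous_conj.comp hFc)
  have h1 : ∀ k : ℕ, ∫ θ in (0 : ℝ)..2 * Real.pi,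
      circlePt θ ^ k * (starRingEnd ℂ ∘ F) θ = 2 * Real.pi * (starRingEnd ℂ) (c k) := by
    intro k
    have h2 := integral_mul_circlePt_pow_mul_conj_pow hc hF 0 k
    have h3 : ∀ θ, circlePt θ ^ k * (starRingEnd ℂ ∘ F) θ =
        (starRingEnd ℂ) (F θ * (circlePt θ ^ 0 * (starRingEnd ℂ) (circlePt θ ^ k))) := by
      intro θ
      simp [mul_comm]
    simp_rw [h3]
    rw [intervalIntegral.intervalIntegral_eq_integral_uIoc] at h2 ⊢
    rw [integral_conj, Complex.real_smul, ← Complex.conj_ofReal, ← map_mul, ← Complex.real_smul, h2]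
    simp [show (starRingEnd ℂ) 2 = 2 from map_ofNat _ 2]
  simp_rw [h1] at h
  have h4 : (∫ θ in (0 : ℝ)..2 * Real.pi, F θ * (starRingEnd ℂ ∘ F) θ) =
      ((∫ θ in (0 : ℝ)..2 * Real.pi, ‖F θ‖ ^ 2 : ℝ) : ℂ) := by
    rw [← intervalIntegral.integral_ofReal]
    refine intervalIntegral.integral_congr fun θ _ => ?_
    simp [Complex.mul_conj, Complex.normSq_eq_norm_sq]
  have h5 : ∀ k, c k * (2 * Real.pi * (starRingEnd ℂ) (c k)) =
      ((2 * Real.pi * ‖c k‖ ^ 2 : ℝ) : ℂ) := by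
    intro k
    rw [mul_left_comm, Complex.mul_conj, Complex.normSq_eq_norm_sq]
    push_cast
    ring
  simp_rw [h4, h5] at h
  have h6 := (Complex.hasSum_ofReal.1 h).mul_left (2 * Real.pi)⁻¹
  have hpi : (2 * Real.pi) ≠ 0 := by positivity
  simpa [← mul_assoc, inv_mul_cancel₀ hpi] using h6

/-- Pairing with the Fejér kernel `|∑_{k < n} exp (ikθ)|²`, whose mean over the circle is `n`. -/
lemma norm_sum_sum_coeff_le (hc : Summable fun k => ‖c k‖)
    (hF : ∀ θ, HasSum (fun k => c k * circlePt θ ^ k) (F θ)) {C : ℝ} (hC : ∀ θ, ‖F θ‖ ≤ C) (n : ℕ) :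
    ‖∑ j ∈ Finset.range n, ∑ k ∈ Finset.range (j + 1), c k‖ ≤ n * C := by
  have hFc := continuous_of_hasSum_circlePt hc hF
  set u : ℝ → ℂ := fun θ => ∑ k ∈ Finset.range n, circlePt θ ^ k with hu
  have huc : Continuous u := by
    rw [hu]
    exact continuous_finsetSum _ fun k _ => continuous_circlePt.pow k
  have hcu : Continuous fun θ => F θ * (u θ * (starRingEnd ℂ) (u θ)) :=
    hFc.mul (huc.mul (Complex.continuous_conj.comp huc))
  have key : ∫ θ in (0 : ℝ)..2 * Real.pi, F θ * (u θ * (starRingEnd ℂ) (u θ)) =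
      2 * Real.pi * ∑ j ∈ Finset.range n, ∑ k ∈ Finset.range (j + 1), c k := by
    have h1 : ∀ θ, F θ * (u θ * (starRingEnd ℂ) (u θ)) =
        ∑ j ∈ Finset.range n, ∑ i ∈ Finset.range n,
          F θ * (circlePt θ ^ i * (starRingEnd ℂ) (circlePt θ ^ j)) := by
      intro θ
      simp only [hu, map_sum, Finset.sum_mul, Finset.mul_sum]
    simp_rw [h1]
    have hint : ∀ i j : ℕ, IntervalIntegrable
        (fun θ => F θ * (circlePt θ ^ i * (starRingEnd ℂ) (circlePt θ ^ j)))
        MeasureTheory.volume 0 (2 * Real.pi) := fun i j =>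
      (hFc.mul ((continuous_circlePt.pow i).mul
        (Complex.continuous_conj.comp (continuous_circlePt.pow j)))).intervalIntegrable _ _
    have hint2 : ∀ j : ℕ, IntervalIntegrable (fun θ => ∑ i ∈ Finset.range n,
        F θ * (circlePt θ ^ i * (starRingEnd ℂ) (circlePt θ ^ j)))
        MeasureTheory.volume 0 (2 * Real.pi) := fun j =>
      (continuous_finsetSum _ fun i _ => hFc.mul ((continuous_circlePt.pow i).mul
        (Complex.continuous_conj.comp (continuous_circlePt.pow j)))).intervalIntegrable _ _
    rw [intervalIntegral.integral_finsetSum fun j _ => hint2 j, Finset.mul_sum]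
    refine Finset.sum_congr rfl fun j hj => ?_
    rw [intervalIntegral.integral_finsetSum fun i _ => hint i j]
    simp_rw [integral_mul_circlePt_pow_mul_conj_pow hc hF]
    rw [← Finset.mul_sum, ← Finset.sum_range_reflect c (j + 1)]
    congr 1
    rw [← Finset.sum_filter]
    refine Finset.sum_congr ?_ fun i hi => by congr 1
    ext i
    simp only [Finset.mem_filter, Finset.mem_range] at hj ⊢
    omega
  have hu2 : ∫ θ in (0 : ℝ)..2 * Real.pi, ‖u θ‖ ^ 2 = 2 * Real.pi * n := by
    have h1 : Summable fun k : ℕ => ‖if k < n then (1 : ℂ) else 0‖ :=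
      summable_of_ne_finset_zero (s := Finset.range n) fun k hk => by
        simp [Finset.mem_range] at hk
        simp [hk]
    have h2 : ∀ θ, HasSum (fun k => (if k < n then (1 : ℂ) else 0) * circlePt θ ^ k) (u θ) := by
      intro θ
      have h3 : u θ = ∑ k ∈ Finset.range n, (if k < n then (1 : ℂ) else 0) * circlePt θ ^ k :=
        Finset.sum_congr rfl fun k hk => by simp [Finset.mem_range.1 hk]
      rw [h3]
      refine hasSum_sum_of_ne_finset_zero fun k hk => ?_
      simp [Finset.mem_range] at hk
      simp [hk]
    have h3 := hasSum_norm_sq_circlePt h1 h2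
    have h4 : HasSum (fun k => ‖if k < n then (1 : ℂ) else 0‖ ^ 2) (n : ℝ) := by
      have h5 : (n : ℝ) = ∑ k ∈ Finset.range n, ‖if k < n then (1 : ℂ) else 0‖ ^ 2 := by
        rw [Finset.sum_congr rfl fun k hk => by rw [if_pos (Finset.mem_range.1 hk)]]
        simp
      rw [h5]
      refine hasSum_sum_of_ne_finset_zero fun k hk => ?_
      simp [Finset.mem_range] at hk
      simp [hk]
    have h5 := h3.unique h4
    have hpi : (2 * Real.pi) ≠ 0 := by positivity
    rw [← h5, mul_inv_cancel_left₀ hpi]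
  have hpi : (0 : ℝ) < 2 * Real.pi := by positivity
  have hb : ‖∫ θ in (0 : ℝ)..2 * Real.pi, F θ * (u θ * (starRingEnd ℂ) (u θ))‖ ≤
      ∫ θ in (0 : ℝ)..2 * Real.pi, C * ‖u θ‖ ^ 2 := by
    refine (intervalIntegral.norm_integral_le_integral_norm hpi.le).trans
      (intervalIntegral.integral_mono_on hpi.le (hcu.norm.intervalIntegrable _ _)
        ((continuous_const.mul (huc.norm.pow 2)).intervalIntegrable _ _) fun θ _ => ?_)
    rw [norm_mul, norm_mul, RCLike.norm_conj, ← sq]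
    exact mul_le_mul_of_nonneg_right (hC θ) (by positivity)
  rw [key, intervalIntegral.integral_const_mul, hu2, norm_mul] at hb
  have h2pi : ‖(2 * Real.pi : ℂ)‖ = 2 * Real.pi := by
    rw [← Complex.ofReal_ofNat, ← Complex.ofReal_mul, Complex.norm_of_nonneg hpi.le]
  rw [h2pi] at hb
  refine le_of_mul_le_mul_left (hb.trans (le_of_eq ?_)) hpi
  ring

end CircleSeries

/-! ### Taylor coefficients and the weighted norm -/

lemma mem_disc {z : ℂ} : z ∈ disc ↔ ‖z‖ < 1 := by simp [disc]

/-- A holomorphic function on the disc is the sum of its Taylor series there. -/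
lemma hasSum_taylorCoeff {f : ℂ → ℂ} (hf : DifferentiableOn ℂ f disc) {z : ℂ} (hz : ‖z‖ < 1) :
    HasSum (fun k => taylorCoeff f k * z ^ k) (f z) := by
  have h := Complex.hasSum_taylorSeries_on_ball hf (mem_disc.2 hz)
  refine h.congr_fun fun k => ?_
  simp only [taylorCoeff, sub_zero, smul_eq_mul]
  ring

lemma hasFPowerSeriesOnBall_ofScalars {f : ℂ → ℂ} {c : ℕ → ℂ}
    (h : ∀ z, ‖z‖ < 1 → HasSum (fun k => c k * z ^ k) (f z)) :
    HasFPowerSeriesOnBall f (FormalMultilinearSeries.ofScalars ℂ c) 0 1 where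
  r_le := by
    refine ENNReal.le_of_forall_nnreal_lt fun r hr => ?_
    refine FormalMultilinearSeries.le_radius_of_summable_norm _ ?_
    have h1 := (h (r : ℂ) (by simpa using hr)).summable.norm
    exact h1.congr fun k => by simp
  r_pos := one_pos
  hasSum := by
    intro z hz
    have hz' : ‖z‖ < 1 := by
      rw [← ENNReal.ofReal_one, Metric.eball_ofReal] at hz
      simpa using hz
    simpa [FormalMultilinearSeries.ofScalars_apply_eq, mul_comm] using h z hz'

lemma differentiableOn_disc_of_hasSum {f : ℂ → ℂ} {c : ℕ → ℂ}
    (h : ∀ z, ‖z‖ < 1 → HasSum (fun k => c k * z ^ k) (f z)) : DifferentiableOn ℂ f disc := by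
  have h1 := (hasFPowerSeriesOnBall_ofScalars h).differentiableOn
  rwa [← ENNReal.ofReal_one, Metric.eball_ofReal] at h1

lemma taylorCoeff_of_hasSum {f : ℂ → ℂ} {c : ℕ → ℂ}
    (h : ∀ z, ‖z‖ < 1 → HasSum (fun k => c k * z ^ k) (f z)) (k : ℕ) : taylorCoeff f k = c k := by
  have h1 := (hasFPowerSeriesOnBall_ofScalars h).factorial_smul 1 k
  rw [← iteratedDeriv_eq_iteratedFDeriv] at h1
  rw [taylorCoeff, ← h1]
  simp [Nat.factorial_ne_zero]

/-- The norm of `l_a^p(α)` is the `ℓ^p` norm of the weighted coefficients `|f̂(k)| (k+1)^α`. -/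
lemma laNorm_eq {p : ℝ} (hp : 0 < p) (α : ℝ) (f : ℂ → ℂ) :
    laNorm p α f =
      (∑' k : ℕ, ENNReal.ofReal (‖taylorCoeff f k‖ * ((k : ℝ) + 1) ^ α) ^ p) ^ (1 / p) := by
  unfold laNorm
  congr 1
  refine tsum_congr fun k => ?_
  have hk : (0 : ℝ) < (k : ℝ) + 1 := by positivity
  rw [ENNReal.ofReal_mul (norm_nonneg _), ENNReal.mul_rpow_of_nonneg _ _ hp.le, ofReal_norm,
    ← ENNReal.ofReal_rpow_of_pos hk, ← ENNReal.rpow_mul, mul_comm α p,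
    ENNReal.ofReal_add (by positivity) one_pos.le, ENNReal.ofReal_natCast, ENNReal.ofReal_one]

/-! ### The lower bound: the Fejér kernel at a multiple point -/

/-- The Taylor coefficients of a function bounded by `C` on the disc satisfy
`|∑_{j < n} ∑_{k ≤ j} ĝ(k)| ≤ n C`. -/
lemma norm_sum_sum_coeff_le_of_bounded {g : ℂ → ℂ} {c : ℕ → ℂ}
    (hg : ∀ z, ‖z‖ < 1 → HasSum (fun k => c k * z ^ k) (g z)) {C : ℝ}
    (hC : ∀ z, ‖z‖ < 1 → ‖g z‖ ≤ C) (n : ℕ) :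
    ‖∑ j ∈ Finset.range n, ∑ k ∈ Finset.range (j + 1), c k‖ ≤ n * C := by
  have h1 : ∀ t : ℝ, t ∈ Set.Ioo (0 : ℝ) 1 →
      ‖∑ j ∈ Finset.range n, ∑ k ∈ Finset.range (j + 1), c k * (t : ℂ) ^ k‖ ≤ n * C := by
    intro t ht
    have hnorm : ∀ θ, ‖(t : ℂ) * circlePt θ‖ < 1 := fun θ => by
      simpa [norm_circlePt, abs_of_pos ht.1] using ht.2
    refine norm_sum_sum_coeff_le (F := fun θ => g (t * circlePt θ)) ?_ (fun θ => ?_)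
      (fun θ => hC _ (hnorm θ)) n
    · exact (hg t (by simpa [abs_of_pos ht.1] using ht.2)).summable.norm
    · simpa [mul_pow, mul_assoc] using hg _ (hnorm θ)
  have h2 : Continuous fun t : ℝ =>
      ‖∑ j ∈ Finset.range n, ∑ k ∈ Finset.range (j + 1), c k * (t : ℂ) ^ k‖ := by fun_prop
  have h3 := (h2.tendsto 1).mono_left (nhdsWithin_le_nhds (s := Set.Iio 1))
  have h4 := le_of_tendsto h3 (Filter.eventually_of_mem (Ioo_mem_nhdsLT one_pos) h1)
  simpa using h4

lemma sum_sum_range_succ_eq (b : ℕ → ℝ) (n : ℕ) :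
    ∑ j ∈ Finset.range n, ∑ k ∈ Finset.range (j + 1), b k =
      ∑ k ∈ Finset.range n, ((n : ℝ) - k) * b k := by
  induction n with
  | zero => simp
  | succ n ih =>
    rw [Finset.sum_range_succ, ih, Finset.sum_range_succ b, Finset.sum_range_succ _ n, ← add_assoc,
      ← Finset.sum_add_distrib]
    push_cast
    congr 1
    · exact Finset.sum_congr rfl fun k _ => by ring
    · ring

/-- Keeping only the terms with `k + 1 ≥ n / 2` gives the order `n ^ (s + 2)` of the Fejér sum. -/
lemma le_sum_sum_rpow {s : ℝ} (hs : 0 ≤ s) (n : ℕ) :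
    (n : ℝ) ^ 2 / 8 * ((n : ℝ) / 2) ^ s ≤
      ∑ j ∈ Finset.range n, ∑ k ∈ Finset.range (j + 1), ((k : ℝ) + 1) ^ s := by
  rw [sum_sum_range_succ_eq, ← Finset.sum_range_reflect]
  set m := (n + 1) / 2 with hm
  have hmn : m ≤ n := by omega
  have hm2 : (n : ℝ) ≤ 2 * m := by
    have : n ≤ 2 * m := by omega
    exact_mod_cast this
  have hsum : ∀ m : ℕ, ∑ l ∈ Finset.range m, ((l : ℝ) + 1) = m * (m + 1) / 2 := by
    intro m
    induction m with
    | zero => simp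
    | succ m ih =>
      rw [Finset.sum_range_succ, ih]
      push_cast
      ring
  calc (n : ℝ) ^ 2 / 8 * ((n : ℝ) / 2) ^ s
      ≤ ((m : ℝ) * (m + 1) / 2) * ((n : ℝ) / 2) ^ s := by
        refine mul_le_mul_of_nonneg_right ?_ (by positivity)
        have : (0 : ℝ) ≤ n := n.cast_nonneg
        nlinarith
    _ = ∑ l ∈ Finset.range m, ((l : ℝ) + 1) * ((n : ℝ) / 2) ^ s := by
        rw [← Finset.sum_mul, hsum]
    _ ≤ ∑ l ∈ Finset.range m, ((n : ℝ) - (n - 1 - l : ℕ)) * (((n - 1 - l : ℕ) : ℝ) + 1) ^ s := by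
        refine Finset.sum_le_sum fun l hl => ?_
        have hl' := Finset.mem_range.1 hl
        have h1 : ((n - 1 - l : ℕ) : ℝ) = n - 1 - l := by
          rw [Nat.cast_sub (by omega), Nat.cast_sub (by omega)]
          simp
        have h2 : 2 * (l : ℝ) + 1 ≤ n := by
          have : 2 * l + 1 ≤ n := by omega
          exact_mod_cast this
        rw [h1]
        gcongr
        · linarith
        · linarith
        · linarith
    _ ≤ _ := by
        refine Finset.sum_le_sum_of_subset_of_nonneg
          (Finset.range_subset_range.2 hmn) fun l hl _ => ?_
        have hl' := Finset.mem_range.1 hl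
        have h1 : ((n - 1 - l : ℕ) : ℝ) ≤ n := by
          have : n - 1 - l ≤ n := by omega
          exact_mod_cast this
        exact mul_nonneg (by linarith) (by positivity)

lemma blaschke_replicate_zero (n : ℕ) (z : ℂ) :
    blaschke (Multiset.replicate n 0) z = (-z) ^ n := by
  simp [blaschke, Multiset.map_replicate, Multiset.prod_replicate]

lemma laNorm_eq_one_of_taylorCoeff {p : ℝ} (hp : 0 < p) (α : ℝ) {n : ℕ} (hn : 1 ≤ n) {f : ℂ → ℂ}
    (hf : ∀ k, taylorCoeff f k =
      if k < n then (((n : ℝ) ^ (-(1 / p)) * ((k : ℝ) + 1) ^ (-α) : ℝ) : ℂ) else 0) :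
    laNorm p α f = 1 := by
  have hn0 : (0 : ℝ) < n := by exact_mod_cast hn
  rw [laNorm_eq hp]
  have h1 : ∀ k, ENNReal.ofReal (‖taylorCoeff f k‖ * ((k : ℝ) + 1) ^ α) ^ p =
      if k < n then ENNReal.ofReal ((n : ℝ)⁻¹) else 0 := by
    intro k
    rw [hf k]
    split_ifs
    · have hk : (0 : ℝ) < (k : ℝ) + 1 := by positivity
      rw [Complex.norm_of_nonneg (by positivity), mul_assoc, ← Real.rpow_add hk, neg_add_cancel,
        Real.rpow_zero, mul_one, ENNReal.ofReal_rpow_of_pos (by positivity),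
        ← Real.rpow_mul hn0.le, show -(1 / p) * p = -1 by field_simp, Real.rpow_neg_one]
    · simp [hp]
  simp_rw [h1]
  rw [tsum_eq_sum (s := Finset.range n) fun k hk => if_neg (by simpa using hk),
    Finset.sum_congr rfl fun k hk => if_pos (Finset.mem_range.1 hk)]
  rw [Finset.sum_const, Finset.card_range, nsmul_eq_mul, ← ENNReal.ofReal_natCast,
    ← ENNReal.ofReal_mul hn0.le, mul_inv_cancel₀ hn0.ne']
  simp

/-- The lower bound, tested on `σ = (0, …, 0)` and `f = n^(-1/p) ∑_{k < n} (k+1)^(-α) z^k`. -/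
theorem le_interpConstSup {p α : ℝ} (hp : 1 ≤ p) (hα : α ≤ 0) {n : ℕ} (hn : 1 ≤ n) {r : ℝ}
    (hr : 0 ≤ r) :
    ENNReal.ofReal ((2 : ℝ) ^ α / 8 * (n : ℝ) ^ (1 - α - 1 / p)) ≤
      interpConstSup n r (laNorm p α) supNorm := by
  have hp0 : 0 < p := by linarith
  have hn0 : (0 : ℝ) < n := by exact_mod_cast hn
  set κ : ℝ := (n : ℝ) ^ (-(1 / p)) with hκ
  have hκ0 : 0 < κ := by positivity
  set b : ℕ → ℝ := fun k => κ * ((k : ℝ) + 1) ^ (-α) with hb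
  set f : ℂ → ℂ := fun z => ∑ k ∈ Finset.range n, (b k : ℂ) * z ^ k with hf
  set c : ℕ → ℂ := fun k => if k < n then (b k : ℂ) else 0 with hc
  have hfc : ∀ z, HasSum (fun k => c k * z ^ k) (f z) := by
    intro z
    have h3 : f z = ∑ k ∈ Finset.range n, c k * z ^ k :=
      Finset.sum_congr rfl fun k hk => by simp [hc, Finset.mem_range.1 hk]
    rw [h3]
    refine hasSum_sum_of_ne_finset_zero fun k hk => ?_
    simp [Finset.mem_range] at hk
    simp [hc, hk]
  have hnorm : laNorm p α f = 1 :=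
    laNorm_eq_one_of_taylorCoeff hp0 α hn fun k => taylorCoeff_of_hasSum (fun z _ => hfc z) k
  have hfX : f ∈ holSpace (laNorm p α) :=
    ⟨differentiableOn_disc_of_hasSum fun z _ => hfc z, by rw [hnorm]; exact ENNReal.one_lt_top⟩
  have hσ : Multiset.replicate n (0 : ℂ) ∈ {σ : Multiset ℂ | σ.card ≤ n ∧ ∀ a ∈ σ, ‖a‖ ≤ r} := by
    refine ⟨by simp, fun a ha => ?_⟩
    rw [Multiset.eq_of_mem_replicate ha]
    simpa using hr
  refine le_trans ?_ (le_iSup₂_of_le (f := fun σ (_ : σ ∈ _) =>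
    interpConst σ (laNorm p α) supNorm) _ hσ le_rfl)
  refine le_trans ?_ (le_iSup₂_of_le f ⟨hfX, hnorm.le⟩ le_rfl)
  refine le_iInf₂ fun g hg => ?_
  obtain ⟨⟨-, hgfin⟩, h, ⟨hhd, -⟩, hgh⟩ := hg
  set G := (supNorm g).toReal with hG
  have hGle : ∀ z, ‖z‖ < 1 → ‖g z‖ ≤ G := by
    intro z hz
    have h1 : ‖g z‖ₑ ≤ supNorm g := le_iSup₂_of_le (f := fun z (_ : z ∈ disc) => ‖g z‖ₑ) z
      (mem_disc.2 hz) le_rfl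
    simpa using ENNReal.toReal_mono hgfin.ne h1
  -- modulo `z ^ n`, the Taylor coefficients of `g` are those of `f`
  set d : ℕ → ℂ := fun k => if k < n then (b k : ℂ) else (-1) ^ n * taylorCoeff h (k - n) with hd
  have hgd : ∀ z, ‖z‖ < 1 → HasSum (fun k => d k * z ^ k) (g z) := by
    intro z hz
    rw [← hasSum_nat_add_iff' n]
    have h1 : g z - ∑ k ∈ Finset.range n, d k * z ^ k = (-1) ^ n * z ^ n * h z := by
      have h2 := hgh z (mem_disc.2 hz)
      rw [blaschke_replicate_zero, neg_pow, Pi.sub_apply] at h2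
      have h3 : ∑ k ∈ Finset.range n, d k * z ^ k = f z := by
        refine Finset.sum_congr rfl fun k hk => ?_
        simp only [hd, if_pos (Finset.mem_range.1 hk)]
      rw [h3, h2]
    rw [h1]
    refine ((hasSum_taylorCoeff hhd hz).mul_left ((-1) ^ n * z ^ n)).congr_fun fun k => ?_
    simp only [hd, if_neg (show ¬ k + n < n by omega), Nat.add_sub_cancel, pow_add]
    ring
  have key := norm_sum_sum_coeff_le_of_bounded hgd hGle n
  have hsum : ∑ j ∈ Finset.range n, ∑ k ∈ Finset.range (j + 1), d k =
      ((κ * ∑ j ∈ Finset.range n, ∑ k ∈ Finset.range (j + 1), ((k : ℝ) + 1) ^ (-α) : ℝ) : ℂ) := by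
    rw [Finset.mul_sum, Complex.ofReal_sum]
    refine Finset.sum_congr rfl fun j hj => ?_
    rw [Finset.mul_sum, Complex.ofReal_sum]
    refine Finset.sum_congr rfl fun k hk => ?_
    have : k < n := by
      have h1 := Finset.mem_range.1 hj
      have h2 := Finset.mem_range.1 hk
      omega
    simp only [hd, if_pos this, hb]
  have hpos : 0 ≤ κ * ∑ j ∈ Finset.range n, ∑ k ∈ Finset.range (j + 1), ((k : ℝ) + 1) ^ (-α) :=
    mul_nonneg hκ0.le (Finset.sum_nonneg fun j _ => Finset.sum_nonneg fun k _ =>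
      Real.rpow_nonneg (by positivity) _)
  rw [hsum, Complex.norm_of_nonneg hpos] at key
  have h5 := (mul_le_mul_of_nonneg_left (le_sum_sum_rpow (neg_nonneg.2 hα) n) hκ0.le).trans key
  have h6 : κ * ((n : ℝ) ^ 2 / 8 * ((n : ℝ) / 2) ^ (-α)) =
      n * ((2 : ℝ) ^ α / 8 * (n : ℝ) ^ (1 - α - 1 / p)) := by
    rw [Real.div_rpow hn0.le two_pos.le, Real.rpow_neg two_pos.le, sub_sub,
      show 1 - (α + 1 / p) = 1 + (-α + -(1 / p)) by ring, Real.rpow_add hn0, Real.rpow_add hn0,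
      Real.rpow_one, div_inv_eq_mul]
    ring
  rw [h6] at h5
  rw [← ENNReal.ofReal_toReal hgfin.ne]
  exact ENNReal.ofReal_le_ofReal (le_of_mul_le_mul_left h5 hn0)

/-! ### Blaschke products slightly outside the disc -/

lemma blaschke_cons (a : ℂ) (σ : Multiset ℂ) (z : ℂ) :
    blaschke (a ::ₘ σ) z = (a - z) / (1 - (starRingEnd ℂ) a * z) * blaschke σ z := by
  simp [blaschke]

lemma one_sub_conj_mul_ne_zero {a z : ℂ} {r : ℝ} (ha : ‖a‖ ≤ r) (hz : r * ‖z‖ < 1) :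
    1 - (starRingEnd ℂ) a * z ≠ 0 := by
  intro h
  have h1 : ‖(starRingEnd ℂ) a * z‖ = 1 := by rw [← sub_eq_zero.1 h]; simp
  rw [norm_mul, RCLike.norm_conj] at h1
  have := mul_le_mul_of_nonneg_right ha (norm_nonneg z)
  linarith

lemma differentiableAt_blaschke {r : ℝ} {z : ℂ} (hz : r * ‖z‖ < 1) (σ : Multiset ℂ) :
    (∀ a ∈ σ, ‖a‖ ≤ r) → DifferentiableAt ℂ (blaschke σ) z := by
  induction σ using Multiset.induction_on with
  | empty =>
    intro _
    rw [show blaschke 0 = fun _ => 1 from funext fun _ => by simp [blaschke]]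
    exact differentiableAt_const _
  | cons a σ ih =>
    intro h
    rw [funext (blaschke_cons a σ)]
    have hne := one_sub_conj_mul_ne_zero (h a (Multiset.mem_cons_self a σ)) hz
    refine DifferentiableAt.mul (DifferentiableAt.div (by fun_prop) (by fun_prop) hne)
      (ih fun b hb => h b (Multiset.mem_cons_of_mem hb))

/-- The reflection of the Blaschke product in the unit circle is its inverse. -/
lemma blaschke_mul_blaschke_inv {r : ℝ} {z : ℂ} (hz0 : r < ‖z‖) (hz : r * ‖z‖ < 1)
    (σ : Multiset ℂ) : (∀ a ∈ σ, ‖a‖ ≤ r) →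
      blaschke σ z * blaschke (σ.map (starRingEnd ℂ)) z⁻¹ = 1 := by
  induction σ using Multiset.induction_on with
  | empty => intro _; simp [blaschke]
  | cons a σ ih =>
    intro h
    have ha := h a (Multiset.mem_cons_self a σ)
    have hne := one_sub_conj_mul_ne_zero ha hz
    have hza : z - a ≠ 0 := by
      intro h1
      rw [sub_eq_zero.1 h1] at hz0
      linarith
    have hz1 : z ≠ 0 := norm_pos_iff.1 (((norm_nonneg a).trans ha).trans_lt hz0)
    rw [Multiset.map_cons, blaschke_cons, blaschke_cons, mul_mul_mul_comm,
      ih fun b hb => h b (Multiset.mem_cons_of_mem hb), mul_one, Complex.conj_conj]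
    have : (starRingEnd ℂ) a - z⁻¹ = -(1 - (starRingEnd ℂ) a * z) * z⁻¹ := by field_simp; ring
    rw [this, show 1 - a * z⁻¹ = (z - a) * z⁻¹ by field_simp]
    generalize 1 - (starRingEnd ℂ) a * z = D at hne
    field_simp
    ring

lemma norm_sq_sub_sub_norm_sq (a z : ℂ) :
    ‖a - z‖ ^ 2 = ‖1 - (starRingEnd ℂ) a * z‖ ^ 2 + (‖z‖ ^ 2 - 1) * (1 - ‖a‖ ^ 2) := by
  simp only [← Complex.normSq_eq_norm_sq, Complex.normSq_apply]
  simp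
  ring

/-- Slightly outside the disc, a Blaschke factor exceeds one only slightly. -/
lemma norm_sq_blaschkeFactor_le {n r : ℝ} (hn : 1 ≤ n) (hr : r < 1) {a z : ℂ} (ha : ‖a‖ ≤ r)
    (hz : ‖z‖ ≤ 1 + (1 - r) / (4 * n)) :
    ‖(a - z) / (1 - (starRingEnd ℂ) a * z)‖ ^ 2 ≤ 1 + 2 / n := by
  have ha0 := norm_nonneg a
  have hz0 := norm_nonneg z
  set x := 1 - ‖a‖ with hx
  have hx0 : 0 < x := by linarith
  set δ := x / (4 * n) with hδ
  have hδ0 : 0 < δ := by positivity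
  have hδn : δ * (4 * n) = x := div_mul_cancel₀ _ (by positivity)
  have hδx : 4 * δ ≤ x := by nlinarith
  have hzδ : ‖z‖ ≤ 1 + δ := by
    have : (1 - r) / (4 * n) ≤ δ := by
      rw [hδ]
      gcongr
      linarith
    linarith
  have hden : 3 / 4 * x ≤ ‖1 - (starRingEnd ℂ) a * z‖ := by
    have h1 := norm_sub_norm_le 1 ((starRingEnd ℂ) a * z)
    rw [norm_mul, RCLike.norm_conj, norm_one] at h1
    have h2 : ‖a‖ * ‖z‖ ≤ ‖a‖ * (1 + δ) := mul_le_mul_of_nonneg_left hzδ ha0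
    nlinarith
  have hden0 : 0 < ‖1 - (starRingEnd ℂ) a * z‖ ^ 2 := by
    have : 0 < ‖1 - (starRingEnd ℂ) a * z‖ := lt_of_lt_of_le (by positivity) hden
    positivity
  rw [norm_div, div_pow, div_le_iff₀ (hden0), norm_sq_sub_sub_norm_sq, add_mul, one_mul]
  have h3 : (3 / 4 * x) ^ 2 ≤ ‖1 - (starRingEnd ℂ) a * z‖ ^ 2 := by gcongr
  have h4 : 1 - ‖a‖ ^ 2 ≤ 2 * x := by nlinarith
  have h4' : 0 ≤ 1 - ‖a‖ ^ 2 := by nlinarith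
  have h5 : ‖z‖ ^ 2 - 1 ≤ 9 / 4 * δ := by nlinarith
  have h6 : (‖z‖ ^ 2 - 1) * (1 - ‖a‖ ^ 2) ≤ 9 / 4 * δ * (2 * x) := by
    refine (mul_le_mul_of_nonneg_right h5 h4').trans (mul_le_mul_of_nonneg_left h4 (by positivity))
  have h7 : 9 / 4 * δ * (2 * x) = 2 / n * (3 / 4 * x) ^ 2 := by
    rw [hδ]
    field_simp
    ring
  have h8 : 2 / n * (3 / 4 * x) ^ 2 ≤ 2 / n * ‖1 - (starRingEnd ℂ) a * z‖ ^ 2 := by gcongr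
  linarith

/-- A Blaschke product with at most `n` zeros of modulus at most `r` stays bounded by an absolute
constant on the disc of radius `1 + (1 - r) / (4 n)`. -/
lemma norm_blaschke_le {n : ℕ} (hn : 1 ≤ n) {r : ℝ} (hr : r < 1) {σ : Multiset ℂ}
    (hcard : σ.card ≤ n) (hσ : ∀ a ∈ σ, ‖a‖ ≤ r) {z : ℂ}
    (hz : ‖z‖ ≤ 1 + (1 - r) / (4 * n)) : ‖blaschke σ z‖ ≤ Real.exp 1 := by
  have hn1 : (1 : ℝ) ≤ n := by exact_mod_cast hn
  have key : ∀ τ : Multiset ℂ, (∀ a ∈ τ, ‖a‖ ≤ r) →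
      ‖blaschke τ z‖ ^ 2 ≤ (1 + 2 / n : ℝ) ^ τ.card := by
    intro τ
    induction τ using Multiset.induction_on with
    | empty => intro _; simp [blaschke]
    | cons a τ ih =>
      intro h
      rw [blaschke_cons, norm_mul, mul_pow, Multiset.card_cons, pow_succ' (1 + 2 / n : ℝ)]
      exact mul_le_mul (norm_sq_blaschkeFactor_le hn1 hr (h a (Multiset.mem_cons_self a τ)) hz)
        (ih fun b hb => h b (Multiset.mem_cons_of_mem hb)) (by positivity) (by positivity)
  refine (pow_le_pow_iff_left₀ (norm_nonneg _) (Real.exp_pos 1).le two_ne_zero).1 ?_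
  calc ‖blaschke σ z‖ ^ 2 ≤ (1 + 2 / n : ℝ) ^ σ.card := key σ hσ
    _ ≤ (1 + 2 / n : ℝ) ^ n := pow_le_pow_right₀ (le_add_of_nonneg_right (by positivity)) hcard
    _ ≤ Real.exp (2 / n) ^ n := by
        gcongr
        rw [add_comm]
        exact Real.add_one_le_exp _
    _ = Real.exp 1 ^ 2 := by
        rw [← Real.exp_nat_mul, ← Real.exp_nat_mul, mul_div_cancel₀ _ (by positivity)]
        simp

lemma hasSum_taylorCoeff_blaschke {r : ℝ} (hr0 : 0 ≤ r) (hr : r < 1) {σ : Multiset ℂ}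
    (hσ : ∀ a ∈ σ, ‖a‖ ≤ r) {w : ℂ} (hw : r * ‖w‖ < 1) :
    HasSum (fun k => taylorCoeff (blaschke σ) k * w ^ k) (blaschke σ w) := by
  have hd : DifferentiableOn ℂ (blaschke σ) (Metric.ball 0 (‖w‖ + (1 - r * ‖w‖) / 2)) := by
    intro z hz
    refine (differentiableAt_blaschke ?_ σ hσ).differentiableWithinAt
    have hz' : ‖z‖ < ‖w‖ + (1 - r * ‖w‖) / 2 := by simpa using hz
    nlinarith
  have h := Complex.hasSum_taylorSeries_on_ball hd (z := w) (by simp; linarith)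
  refine h.congr_fun fun k => ?_
  simp only [taylorCoeff, sub_zero, smul_eq_mul]
  ring

/-- Polynomial growth against exponential growth, with the dependence on the rate made explicit. -/
lemma rpow_le_mul_pow {s M : ℝ} (hs : 0 ≤ s) (hM : 1 ≤ M) (k : ℕ) :
    ((k : ℝ) + 1) ^ s ≤ (8 * (s + 1)) ^ s * M ^ s * (1 + 1 / (4 * M)) ^ k := by
  have hM0 : 0 < M := by linarith
  have hk : (0 : ℝ) ≤ k := k.cast_nonneg
  set x := (k : ℝ) / M with hx
  have hx0 : 0 ≤ x := by positivity
  set C := 8 * (s + 1) with hC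
  have hC0 : 0 < C := by positivity
  have h1 : (k : ℝ) + 1 ≤ C * M * Real.exp (x / C) := by
    have h2 := Real.add_one_le_exp (x / C)
    have h3 : (k : ℝ) = M * x := by rw [hx]; field_simp
    calc (k : ℝ) + 1 ≤ M * (x + C) := by rw [h3]; nlinarith
      _ = C * M * (x / C + 1) := by field_simp
      _ ≤ _ := by gcongr
  have h4 : Real.exp (1 / (8 * M)) ≤ 1 + 1 / (4 * M) := by
    have h5 := Real.add_one_le_exp (-(1 / (8 * M)))
    set y := 1 / (8 * M) with hy
    have hy0 : 0 < y := by positivity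
    have hy1 : y ≤ 1 / 8 := by rw [hy]; gcongr; linarith
    have h6 : 1 / (4 * M) = 2 * y := by rw [hy]; field_simp; norm_num
    rw [h6]
    rw [Real.exp_neg] at h5
    have h7 : Real.exp y * (-y + 1) ≤ 1 := by
      calc Real.exp y * (-y + 1) ≤ Real.exp y * (Real.exp y)⁻¹ := by gcongr
        _ = 1 := mul_inv_cancel₀ (Real.exp_pos y).ne'
    nlinarith [Real.exp_pos y]
  calc ((k : ℝ) + 1) ^ s ≤ (C * M * Real.exp (x / C)) ^ s := by gcongr
    _ = C ^ s * M ^ s * Real.exp (x / C * s) := by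
        rw [Real.mul_rpow (by positivity) (by positivity), Real.mul_rpow hC0.le hM0.le,
          ← Real.exp_mul]
    _ ≤ C ^ s * M ^ s * (1 + 1 / (4 * M)) ^ k := by
        gcongr
        calc Real.exp (x / C * s) ≤ Real.exp (k * (1 / (8 * M))) := by
              refine Real.exp_le_exp.2 ?_
              have : x / C * s = x * (s / C) := by ring
              rw [this, hx, show (k : ℝ) * (1 / (8 * M)) = k / M * (1 / 8) by field_simp]
              refine mul_le_mul_of_nonneg_left ?_ hx0
              rw [div_le_div_iff₀ hC0 (by norm_num)]
              linarith
          _ = Real.exp (1 / (8 * M)) ^ k := Real.exp_nat_mul _ _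
          _ ≤ _ := by gcongr

/-! ### The reproducing kernel of the model space -/

lemma hasSum_geometric_circlePt {q : ℂ} (hq : ‖q‖ < 1) (θ : ℝ) :
    HasSum (fun k => q ^ k * circlePt θ ^ k) (1 - q * circlePt θ)⁻¹ := by
  simp_rw [← mul_pow]
  exact hasSum_geometric_of_norm_lt_one (by simpa [norm_circlePt] using hq)

/-- The Poisson-type integral of `|1 - vζ|⁻²` over `|v| = 1`, for `|ζ| > 1`. -/
lemma integral_inv_norm_sq_one_sub {ζ : ℂ} (hζ : 1 < ‖ζ‖) :
    (2 * Real.pi)⁻¹ * ∫ θ in (0 : ℝ)..2 * Real.pi, (‖1 - ζ * circlePt θ‖ ^ 2)⁻¹ =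
      (‖ζ‖ ^ 2 - 1)⁻¹ := by
  have hζ0 : ζ ≠ 0 := norm_pos_iff.1 (by linarith)
  -- reflect `ζ` in the circle to expand in nonnegative powers
  set q : ℂ := (starRingEnd ℂ) ζ⁻¹ with hq
  have hqn : ‖q‖ = ‖ζ‖⁻¹ := by rw [hq, RCLike.norm_conj, norm_inv]
  have hq1 : ‖q‖ < 1 := by rw [hqn]; exact inv_lt_one_of_one_lt₀ hζ
  have h1 : ∀ θ, (‖1 - ζ * circlePt θ‖ ^ 2)⁻¹ = (‖ζ‖ ^ 2)⁻¹ * ‖(1 - q * circlePt θ)⁻¹‖ ^ 2 := by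
    intro θ
    have h2 : ‖1 - ζ * circlePt θ‖ = ‖ζ‖ * ‖1 - q * circlePt θ‖ := by
      have h3 : 1 - ζ * circlePt θ =
          -(ζ * circlePt θ) * (starRingEnd ℂ) (1 - q * circlePt θ) := by
        have := circlePt_ne_zero θ
        rw [map_sub, map_one, map_mul, conj_circlePt, hq, Complex.conj_conj]
        field_simp
        ring
      rw [h3, norm_mul, RCLike.norm_conj, norm_neg, norm_mul, norm_circlePt, mul_one]
    rw [h2, norm_inv, mul_pow, mul_inv, inv_pow]
  have h4 := hasSum_norm_sq_circlePt (c := fun k => q ^ k)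
    (by simpa using summable_geometric_of_lt_one (norm_nonneg q) hq1)
    (hasSum_geometric_circlePt hq1)
  have h5 : HasSum (fun k : ℕ => ‖q ^ k‖ ^ 2) (1 - ‖q‖ ^ 2)⁻¹ := by
    simp_rw [norm_pow, ← pow_mul, mul_comm _ 2, pow_mul]
    exact hasSum_geometric_of_lt_one (by positivity)
      (pow_lt_one₀ (norm_nonneg q) hq1 two_ne_zero)
  have h6 := h4.unique h5
  simp_rw [h1]
  rw [intervalIntegral.integral_const_mul, mul_left_comm, h6, hqn, ← mul_inv, mul_sub, mul_one,
    inv_pow, mul_inv_cancel₀ (by positivity)]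

/-- The coefficients in `w` of `(1 - b B(w)) / (1 - wζ)`, where `B(w) = ∑ βⱼ wʲ`. When
`βⱼ` are the conjugates of the coefficients of a Blaschke product and `b` is its value at `ζ`, the
`k`-th coefficient is the value at `ζ` of the projection of `z ^ k` to the model space. -/
noncomputable def kernelCoeff (β : ℕ → ℂ) (b ζ : ℂ) (k : ℕ) : ℂ :=
  ζ ^ k - b * ∑ j ∈ Finset.range (k + 1), β j * ζ ^ (k - j)

lemma kernelCoeff_zero (β : ℕ → ℂ) (b ζ : ℂ) : kernelCoeff β b ζ 0 = 1 - b * β 0 := by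
  simp [kernelCoeff]

lemma kernelCoeff_succ (β : ℕ → ℂ) (b ζ : ℂ) (k : ℕ) :
    kernelCoeff β b ζ (k + 1) = ζ * kernelCoeff β b ζ k - b * β (k + 1) := by
  unfold kernelCoeff
  rw [Finset.sum_range_succ _ (k + 1)]
  have h : ∑ j ∈ Finset.range (k + 1), β j * ζ ^ (k + 1 - j) =
      ζ * ∑ j ∈ Finset.range (k + 1), β j * ζ ^ (k - j) := by
    rw [Finset.mul_sum]
    refine Finset.sum_congr rfl fun j hj => ?_
    rw [Nat.sub_add_comm (Nat.lt_succ_iff.1 (Finset.mem_range.1 hj)), pow_succ]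
    ring
  rw [h]
  simp only [Nat.sub_self, pow_zero]
  ring

section Kernel

variable {β : ℕ → ℂ} {B : ℂ → ℂ} {b ζ : ℂ} {R : ℝ}

/-- The singularity of `(1 - b B(w)) / (1 - wζ)` at `w = 1/ζ` is removable when `b B(1/ζ) = 1`, so
the coefficients decay at the rate given by the disc of convergence of `B`. -/
lemma exists_norm_kernelCoeff_le (hR : 1 < R * ‖ζ‖) (hR0 : 0 < R)
    (hB : ∀ w, ‖w‖ ≤ R → HasSum (fun k => β k * w ^ k) (B w)) (hb : b * B ζ⁻¹ = 1) :
    ∃ C, ∀ k, ‖kernelCoeff β b ζ k‖ ≤ C * R⁻¹ ^ k := by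
  have hζn : 0 < ‖ζ‖ := pos_of_mul_pos_right (by linarith) hR0.le
  have hζ0 : ζ ≠ 0 := norm_pos_iff.1 hζn
  obtain ⟨D, hD⟩ : ∃ D, ∀ k, ‖β k‖ * R ^ k ≤ D := by
    have h1 := (hB (R : ℂ) (by simp [abs_of_pos hR0])).summable.norm
    refine ⟨∑' k, ‖β k * (R : ℂ) ^ k‖, fun k => ?_⟩
    have := h1.le_tsum k fun j _ => norm_nonneg _
    simpa [abs_of_pos hR0] using this
  set q := (R * ‖ζ‖)⁻¹ with hq
  have hq0 : 0 < q := by positivity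
  have hq1 : q < 1 := inv_lt_one_of_one_lt₀ hR
  have hζR : ‖ζ⁻¹‖ ≤ R := by
    rw [norm_inv, inv_le_iff_one_le_mul₀ hζn]
    exact hR.le
  refine ⟨‖b‖ * (D * q * (1 - q)⁻¹), fun k => ?_⟩
  have h2 : kernelCoeff β b ζ k =
      b * ζ ^ k * (B ζ⁻¹ - ∑ j ∈ Finset.range (k + 1), β j * ζ⁻¹ ^ j) := by
    have h3 : ∑ j ∈ Finset.range (k + 1), β j * ζ ^ (k - j) =
        ζ ^ k * ∑ j ∈ Finset.range (k + 1), β j * ζ⁻¹ ^ j := by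
      rw [Finset.mul_sum]
      refine Finset.sum_congr rfl fun j hj => ?_
      rw [pow_sub₀ _ hζ0 (Nat.lt_succ_iff.1 (Finset.mem_range.1 hj)), inv_pow]
      ring
    rw [kernelCoeff, h3]
    linear_combination (-ζ ^ k) * hb
  have h4 := (hasSum_nat_add_iff' (k + 1)).2 (hB _ hζR)
  have h5 : HasSum (fun i => D * q ^ (k + 1) * q ^ i) (D * q ^ (k + 1) * (1 - q)⁻¹) :=
    (hasSum_geometric_of_lt_one hq0.le hq1).mul_left _
  have h6 : ‖B ζ⁻¹ - ∑ j ∈ Finset.range (k + 1), β j * ζ⁻¹ ^ j‖ ≤ D * q ^ (k + 1) * (1 - q)⁻¹ := by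
    rw [← h4.tsum_eq]
    refine tsum_of_norm_bounded h5 fun i => ?_
    have h7 : ‖β (i + (k + 1)) * ζ⁻¹ ^ (i + (k + 1))‖ =
        ‖β (i + (k + 1))‖ * R ^ (i + (k + 1)) * q ^ (i + (k + 1)) := by
      rw [norm_mul, norm_pow, norm_inv, mul_assoc, ← mul_pow, hq]
      congr 2
      field_simp
    rw [h7, mul_assoc D, ← pow_add, add_comm (k + 1) i]
    exact mul_le_mul_of_nonneg_right (hD _) (by positivity)
  rw [h2, norm_mul, norm_mul, norm_pow]
  calc ‖b‖ * ‖ζ‖ ^ k * ‖B ζ⁻¹ - ∑ j ∈ Finset.range (k + 1), β j * ζ⁻¹ ^ j‖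
      ≤ ‖b‖ * ‖ζ‖ ^ k * (D * q ^ (k + 1) * (1 - q)⁻¹) := by gcongr
    _ = ‖b‖ * (D * q * (1 - q)⁻¹) * (q * ‖ζ‖) ^ k := by ring
    _ = _ := by
        congr 2
        rw [hq]
        field_simp

lemma hasSum_kernelCoeff {w : ℂ} (hs : Summable fun k => kernelCoeff β b ζ k * w ^ k)
    (hB : HasSum (fun k => β k * w ^ k) (B w)) (hw : ζ * w ≠ 1) :
    HasSum (fun k => kernelCoeff β b ζ k * w ^ k) ((1 - b * B w) / (1 - ζ * w)) := by
  obtain ⟨S, hS⟩ := hs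
  have h1 := (hasSum_nat_add_iff' 1).2 hS
  have h2 : HasSum (fun k => kernelCoeff β b ζ (k + 1) * w ^ (k + 1))
      (ζ * w * S - b * (B w - β 0)) := by
    have h3 := (hasSum_nat_add_iff' 1).2 hB
    simp only [Finset.range_one, Finset.sum_singleton, pow_zero, mul_one] at h3
    refine ((hS.mul_left (ζ * w)).sub (h3.mul_left b)).congr_fun fun k => ?_
    rw [kernelCoeff_succ]
    ring
  have h4 := h1.unique h2
  simp only [Finset.range_one, Finset.sum_singleton, pow_zero, mul_one, kernelCoeff_zero] at h4
  have h5 : (1 - b * B w) / (1 - ζ * w) = S := by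
    rw [div_eq_iff (sub_ne_zero.2 hw.symm)]
    linear_combination -h4
  rwa [h5]

/-- The kernel estimate: by Parseval on the circle of radius `ρ`, slightly larger than one, the
kernel is controlled by the bound `K` for `B` there and by the integral of `|1 - wζ|⁻²`. -/
lemma exists_hasSum_norm_sq_kernelCoeff {ρ K : ℝ} (hρ0 : 0 < ρ) (hρR : ρ < R)
    (hρζ : 1 < ρ * ‖ζ‖)
    (hB : ∀ w, ‖w‖ ≤ R → HasSum (fun k => β k * w ^ k) (B w)) (hb : b * B ζ⁻¹ = 1)
    (hK : ∀ w, ‖w‖ = ρ → ‖1 - b * B w‖ ≤ K) :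
    ∃ T ≤ K ^ 2 * ((ρ * ‖ζ‖) ^ 2 - 1)⁻¹,
      HasSum (fun k => (‖kernelCoeff β b ζ k‖ * ρ ^ k) ^ 2) T := by
  have hR0 : 0 < R := hρ0.trans hρR
  have hζn : 0 < ‖ζ‖ := pos_of_mul_pos_right (by linarith) hρ0.le
  obtain ⟨C, hC⟩ := exists_norm_kernelCoeff_le (hρζ.trans (by gcongr)) hR0 hB hb
  set c : ℕ → ℂ := fun k => kernelCoeff β b ζ k * (ρ : ℂ) ^ k with hc
  have hcn : ∀ k, ‖c k‖ = ‖kernelCoeff β b ζ k‖ * ρ ^ k := fun k => by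
    simp [hc, abs_of_pos hρ0]
  have hcs : Summable fun k => ‖c k‖ := by
    have h1 : Summable fun k : ℕ => C * (R⁻¹ * ρ) ^ k := by
      refine (summable_geometric_of_lt_one (by positivity) ?_).mul_left C
      rw [inv_mul_lt_iff₀ hR0]
      simpa using hρR
    refine Summable.of_nonneg_of_le (fun k => norm_nonneg _) (fun k => ?_) h1
    rw [hcn, mul_pow, ← mul_assoc]
    exact mul_le_mul_of_nonneg_right (hC k) (by positivity)
  have hw : ∀ θ, ‖(ρ : ℂ) * circlePt θ‖ = ρ := fun θ => by simp [norm_circlePt, abs_of_pos hρ0]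
  have hne : ∀ θ, ζ * (ρ * circlePt θ) ≠ 1 := by
    intro θ h
    have h1 := congrArg norm h
    rw [norm_mul, hw, norm_one] at h1
    linarith
  set F : ℝ → ℂ := fun θ => (1 - b * B (ρ * circlePt θ)) / (1 - ζ * (ρ * circlePt θ)) with hF
  have hFs : ∀ θ, HasSum (fun k => c k * circlePt θ ^ k) (F θ) := by
    intro θ
    have h1 : ∀ k, c k * circlePt θ ^ k = kernelCoeff β b ζ k * (ρ * circlePt θ) ^ k := fun k => by
      rw [hc, mul_pow, mul_assoc]
    have h2 : Summable fun k => c k * circlePt θ ^ k := by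
      refine Summable.of_norm ?_
      simpa [norm_circlePt] using hcs
    simp_rw [h1] at h2 ⊢
    exact hasSum_kernelCoeff h2 (hB _ ((hw θ).le.trans hρR.le)) (hne θ)
  have hP := hasSum_norm_sq_circlePt hcs hFs
  simp_rw [hcn] at hP
  refine ⟨_, ?_, hP⟩
  have hFc := continuous_of_hasSum_circlePt hcs hFs
  have hζρ : 1 < ‖ζ * ρ‖ := by
    rw [norm_mul, Complex.norm_of_nonneg hρ0.le, mul_comm]
    exact hρζ
  rw [← Complex.norm_of_nonneg hρ0.le, mul_comm ‖(ρ : ℂ)‖, ← norm_mul,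
    ← integral_inv_norm_sq_one_sub hζρ, mul_left_comm]
  refine mul_le_mul_of_nonneg_left ?_ (by positivity)
  rw [← intervalIntegral.integral_const_mul]
  have hden : Continuous fun θ => (‖1 - ζ * ρ * circlePt θ‖ ^ 2)⁻¹ := by
    refine Continuous.inv₀ ?_ fun θ => ?_
    · exact ((continuous_const.sub (continuous_const.mul continuous_circlePt)).norm).pow 2
    · refine pow_ne_zero 2 (norm_ne_zero_iff.2 (sub_ne_zero.2 ?_))
      rw [mul_assoc]
      exact (hne θ).symm
  refine intervalIntegral.integral_mono_on (by positivity) ((hFc.norm.pow 2).intervalIntegrable _ _)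
    ((continuous_const.mul hden).intervalIntegrable _ _) fun θ _ => ?_
  simp only [hF]
  rw [norm_div, div_pow, div_eq_mul_inv, mul_assoc ζ]
  refine mul_le_mul_of_nonneg_right ?_ (by positivity)
  exact pow_le_pow_left₀ (norm_nonneg _) (hK _ (hw θ)) 2

end Kernel

/-! ### Co-analytic Toeplitz operators on `l_a^p(α)` -/

/-- Correlation with a summable sequence is bounded on `ℓ^p`, by the weighted Hölder inequality. -/
lemma ENNReal.tsum_tsum_mul_rpow_le {p : ℝ} (hp : 1 ≤ p) {γ : ℕ → ℝ≥0∞}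
    (hγ : ∑' j, γ j ≠ ∞) (x : ℕ → ℝ≥0∞) :
    ∑' m, (∑' j, γ j * x (m + j)) ^ p ≤ (∑' j, γ j) ^ p * ∑' k, x k ^ p := by
  have hp0 : 0 < p := by linarith
  have h1 : ∀ m, (∑' j, γ j * x (m + j)) ^ p ≤
      (∑' j, γ j) ^ (p - 1) * ∑' j, γ j * x (m + j) ^ p := by
    intro m
    have h2 : ∑' j, γ j * x (m + j) ≤
        (∑' j, γ j) ^ (1 - p⁻¹) * (∑' j, γ j * x (m + j) ^ p) ^ p⁻¹ := by
      rw [ENNReal.tsum_eq_iSup_sum]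
      refine iSup_le fun s => ?_
      refine (ENNReal.inner_le_weight_mul_Lp_of_nonneg s hp γ fun j => x (m + j)).trans ?_
      have : 0 ≤ 1 - p⁻¹ := sub_nonneg.2 (inv_le_one_of_one_le₀ hp)
      gcongr
      · exact ENNReal.sum_le_tsum s
      · exact ENNReal.sum_le_tsum s
    refine (ENNReal.rpow_le_rpow h2 hp0.le).trans (le_of_eq ?_)
    rw [ENNReal.mul_rpow_of_nonneg _ _ hp0.le, ← ENNReal.rpow_mul, ← ENNReal.rpow_mul,
      inv_mul_cancel₀ hp0.ne', ENNReal.rpow_one, sub_mul, inv_mul_cancel₀ hp0.ne', one_mul]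
  calc ∑' m, (∑' j, γ j * x (m + j)) ^ p
      ≤ ∑' m, (∑' j, γ j) ^ (p - 1) * ∑' j, γ j * x (m + j) ^ p := ENNReal.tsum_le_tsum h1
    _ = (∑' j, γ j) ^ (p - 1) * ∑' j, γ j * ∑' m, x (m + j) ^ p := by
        rw [ENNReal.tsum_mul_left, ENNReal.tsum_comm]
        simp_rw [ENNReal.tsum_mul_left]
    _ ≤ (∑' j, γ j) ^ (p - 1) * ∑' j, γ j * ∑' k, x k ^ p := by
        gcongr (∑' j, γ j) ^ (p - 1) * ?_
        refine ENNReal.tsum_le_tsum fun j => ?_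
        gcongr γ j * ?_
        exact ENNReal.tsum_comp_le_tsum_of_injective (add_left_injective j) fun k => x k ^ p
    _ = (∑' j, γ j) ^ p * ∑' k, x k ^ p := by
        rw [ENNReal.tsum_mul_right, ← mul_assoc]
        congr 1
        rcases eq_or_ne (∑' j, γ j) 0 with h0 | h0
        · rw [h0, mul_zero, ENNReal.zero_rpow_of_pos hp0]
        · nth_rewrite 2 [← ENNReal.rpow_one (∑' j, γ j)]
          rw [← ENNReal.rpow_add _ _ h0 hγ, sub_add_cancel]

/-- Submultiplicativity of the weight. -/
lemma add_add_one_rpow_le {s : ℝ} (hs : 0 ≤ s) (m j : ℕ) :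
    (((m + j : ℕ) : ℝ) + 1) ^ s ≤ ((m : ℝ) + 1) ^ s * ((j : ℝ) + 1) ^ s := by
  rw [← Real.mul_rpow (by positivity) (by positivity)]
  refine Real.rpow_le_rpow (by positivity) ?_ hs
  push_cast
  nlinarith [mul_nonneg (Nat.cast_nonneg (α := ℝ) m) (Nat.cast_nonneg (α := ℝ) j)]

/-- The coefficients `∑ⱼ βⱼ a_{m+j}` of the image of `∑ aₖ zᵏ` under the co-analytic Toeplitz
operator with symbol the conjugate of `∑ conj βⱼ zʲ`. -/
noncomputable def toeplitzCoeff (β a : ℕ → ℂ) (m : ℕ) : ℂ := ∑' j, β j * a (m + j)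

/-- Co-analytic Toeplitz operators with rapidly decreasing symbols act on `l_a^p(α)`. -/
lemma tsum_toeplitzCoeff_lt_top {p α : ℝ} (hp : 1 ≤ p) (hα : α ≤ 0) {β a : ℕ → ℂ}
    (hβ : Summable fun j => ‖β j‖ * ((j : ℝ) + 1) ^ (-α))
    (ha : ∑' k : ℕ, ENNReal.ofReal (‖a k‖ * ((k : ℝ) + 1) ^ α) ^ p < ∞) :
    ∑' m : ℕ, ENNReal.ofReal (‖toeplitzCoeff β a m‖ * ((m : ℝ) + 1) ^ α) ^ p < ∞ := by
  have hp0 : 0 ≤ p := by linarith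
  set γ : ℕ → ℝ≥0∞ := fun j => ENNReal.ofReal (‖β j‖ * ((j : ℝ) + 1) ^ (-α)) with hγ
  set x : ℕ → ℝ≥0∞ := fun k => ENNReal.ofReal (‖a k‖ * ((k : ℝ) + 1) ^ α) with hx
  have hγs : ∑' j, γ j ≠ ∞ := hβ.tsum_ofReal_ne_top
  have h1 : ∀ m : ℕ, ENNReal.ofReal (‖toeplitzCoeff β a m‖ * ((m : ℝ) + 1) ^ α) ≤
      ∑' j, γ j * x (m + j) := by
    intro m
    rw [ENNReal.ofReal_mul (norm_nonneg _), ofReal_norm]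
    refine (mul_le_mul_left (enorm_tsum_le_tsum_enorm (f := fun j => β j * a (m + j))) _).trans ?_
    rw [← ENNReal.tsum_mul_right]
    refine ENNReal.tsum_le_tsum fun j => ?_
    rw [← ofReal_norm, ← ENNReal.ofReal_mul (norm_nonneg _), hγ, hx,
      ← ENNReal.ofReal_mul (by positivity)]
    refine ENNReal.ofReal_le_ofReal ?_
    have h2 := add_add_one_rpow_le (neg_nonneg.2 hα) m j
    rw [Real.rpow_neg (by positivity), Real.rpow_neg (by positivity)] at h2
    have h3 : ((m : ℝ) + 1) ^ α ≤ ((j : ℝ) + 1) ^ (-α) * (((m + j : ℕ) : ℝ) + 1) ^ α := by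
      have hpos : (0 : ℝ) < (((m + j : ℕ) : ℝ) + 1) ^ α := by positivity
      have hpos' : (0 : ℝ) < ((m : ℝ) + 1) ^ α := by positivity
      rw [inv_le_iff_one_le_mul₀ hpos] at h2
      calc ((m : ℝ) + 1) ^ α = ((m : ℝ) + 1) ^ α * 1 := (mul_one _).symm
        _ ≤ ((m : ℝ) + 1) ^ α * ((((m : ℝ) + 1) ^ α)⁻¹ * ((j : ℝ) + 1) ^ (-α) *
              (((m + j : ℕ) : ℝ) + 1) ^ α) := mul_le_mul_of_nonneg_left h2 hpos'.le
        _ = _ := by field_simp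
    rw [norm_mul]
    calc ‖β j‖ * ‖a (m + j)‖ * ((m : ℝ) + 1) ^ α
        ≤ ‖β j‖ * ‖a (m + j)‖ * (((j : ℝ) + 1) ^ (-α) * (((m + j : ℕ) : ℝ) + 1) ^ α) := by gcongr
      _ = _ := by ring
  calc ∑' m : ℕ, ENNReal.ofReal (‖toeplitzCoeff β a m‖ * ((m : ℝ) + 1) ^ α) ^ p
      ≤ ∑' m, (∑' j, γ j * x (m + j)) ^ p :=
        ENNReal.tsum_le_tsum fun m => ENNReal.rpow_le_rpow (h1 m) hp0
    _ ≤ (∑' j, γ j) ^ p * ∑' k, x k ^ p := ENNReal.tsum_tsum_mul_rpow_le hp hγs x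
    _ < ∞ := ENNReal.mul_lt_top (ENNReal.rpow_lt_top_of_nonneg hp0 hγs) ha

lemma summable_norm_pow_mul_rpow {s : ℝ} (hs : 0 ≤ s) {ζ : ℂ} (hζ : ‖ζ‖ < 1) :
    Summable fun m : ℕ => ‖ζ‖ ^ m * ((m : ℝ) + 1) ^ s := by
  have h0 := norm_nonneg ζ
  set M := (1 - ‖ζ‖)⁻¹ with hM
  have hM1 : 1 ≤ M := (one_le_inv₀ (by linarith)).2 (by linarith)
  have h1 : 1 / (4 * M) = (1 - ‖ζ‖) / 4 := by rw [hM]; field_simp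
  have h2 : ‖ζ‖ * (1 + 1 / (4 * M)) < 1 := by rw [h1]; nlinarith
  refine Summable.of_nonneg_of_le (fun m => by positivity) (fun m => ?_)
    ((summable_geometric_of_lt_one (by positivity) h2).mul_left ((8 * (s + 1)) ^ s * M ^ s))
  calc ‖ζ‖ ^ m * ((m : ℝ) + 1) ^ s
      ≤ ‖ζ‖ ^ m * ((8 * (s + 1)) ^ s * M ^ s * (1 + 1 / (4 * M)) ^ m) := by
        gcongr
        exact rpow_le_mul_pow hs hM1 m
    _ = _ := by rw [mul_pow]; ring

/-- The image of `∑ aₖ zᵏ` under the Toeplitz operator, as a power series and as a sum over the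
images of the monomials. -/
lemma exists_hasSum_toeplitzCoeff {s : ℝ} (hs : 0 ≤ s) {β a : ℕ → ℂ}
    (hβ : Summable fun j => ‖β j‖ * ((j : ℝ) + 1) ^ s)
    (ha : ∀ k, ‖a k‖ ≤ ((k : ℝ) + 1) ^ s) {ζ : ℂ} (hζ : ‖ζ‖ < 1) :
    ∃ H, HasSum (fun m => toeplitzCoeff β a m * ζ ^ m) H ∧
      HasSum (fun k => a k * ∑ j ∈ Finset.range (k + 1), β j * ζ ^ (k - j)) H := by
  set Φ : ℕ × ℕ → ℂ := fun q => β q.1 * ζ ^ q.2 * a (q.1 + q.2) with hΦ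
  have hΦs : Summable Φ := by
    refine Summable.of_norm_bounded
      (hβ.mul_of_nonneg (summable_norm_pow_mul_rpow hs hζ) (fun j => by positivity)
        fun m => by positivity) fun q => ?_
    rw [hΦ, norm_mul, norm_mul, norm_pow]
    calc ‖β q.1‖ * ‖ζ‖ ^ q.2 * ‖a (q.1 + q.2)‖
        ≤ ‖β q.1‖ * ‖ζ‖ ^ q.2 * (((q.1 : ℝ) + 1) ^ s * ((q.2 : ℝ) + 1) ^ s) := by
          gcongr
          exact (ha _).trans (add_add_one_rpow_le hs _ _)
      _ = _ := by ring
  obtain ⟨H, hH⟩ := hΦs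
  refine ⟨H, ?_, ?_⟩
  · have h1 : HasSum (fun q : ℕ × ℕ => Φ q.swap) H := (Equiv.prodComm ℕ ℕ).hasSum_iff.2 hH
    refine h1.prod_fiberwise fun m => ?_
    have h2 : Summable fun j => Φ (m, j).swap := h1.summable.prod_factor m
    have h3 : toeplitzCoeff β a m * ζ ^ m = ∑' j, Φ (m, j).swap := by
      rw [toeplitzCoeff, ← tsum_mul_right]
      refine tsum_congr fun j => ?_
      simp only [hΦ, Prod.swap, add_comm j m]
      ring
    rw [h3]
    exact h2.hasSum
  · have h1 := Finset.HasAntidiagonal.sigmaAntidiagonalEquivProd.hasSum_iff.2 hH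
    refine h1.sigma fun k => ?_
    have h2 : a k * ∑ j ∈ Finset.range (k + 1), β j * ζ ^ (k - j) =
        ∑ q ∈ Finset.HasAntidiagonal.antidiagonal k, Φ q := by
      rw [Finset.Nat.sum_antidiagonal_eq_sum_range_succ_mk, Finset.mul_sum]
      refine Finset.sum_congr rfl fun j hj => ?_
      simp only [hΦ]
      rw [Nat.add_sub_cancel' (Nat.lt_succ_iff.1 (Finset.mem_range.1 hj))]
      ring
    rw [h2, ← Finset.sum_coe_sort]
    exact hasSum_fintype _

/-! ### The upper bound: the Toeplitz interpolant -/

lemma ENNReal.le_one_of_rpow_le_one {x : ℝ≥0∞} {q : ℝ} (hq : 0 < q) (h : x ^ q ≤ 1) : x ≤ 1 := by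
  by_contra h1
  exact absurd h (not_le.2 (ENNReal.one_lt_rpow (not_le.1 h1) hq))

/-- The bound on the Toeplitz interpolant `f - B h` near the unit circle. -/
lemma norm_toeplitz_interpolant_le {p s : ℝ} (hs : 0 ≤ s) (hp : 0 < p) (hp2 : p ≤ 2) {a β : ℕ → ℂ}
    (ha : ∑' k : ℕ, ENNReal.ofReal (‖a k‖ * ((k : ℝ) + 1) ^ (-s)) ^ p ≤ 1)
    {M : ℝ} (hM : 1 ≤ M) {b ζ fζ H : ℂ} {T : ℝ}
    (hf : HasSum (fun k => a k * ζ ^ k) fζ)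
    (hH : HasSum (fun k => a k * ∑ j ∈ Finset.range (k + 1), β j * ζ ^ (k - j)) H)
    (hT : HasSum (fun k => (‖kernelCoeff β b ζ k‖ * (1 + 1 / (4 * M)) ^ k) ^ 2) T) :
    ‖fζ - b * H‖ ≤ (8 * (s + 1)) ^ s * M ^ s * √T := by
  set D := (8 * (s + 1)) ^ s * M ^ s with hD
  have hD0 : 0 ≤ D := by positivity
  set x : ℕ → ℝ := fun k => ‖a k‖ * ((k : ℝ) + 1) ^ (-s) with hx
  have hx0 : ∀ k, 0 ≤ x k := fun k => by positivity
  -- the unit ball of `ℓ^p` lies in that of `ℓ^2`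
  have hx2 : ∑' k, ENNReal.ofReal (x k ^ 2) ≤ 1 := by
    refine (ENNReal.tsum_le_tsum fun k => ?_).trans ha
    have h1 : ENNReal.ofReal (x k) ^ p ≤ 1 := (ENNReal.le_tsum k).trans ha
    have h2 : ENNReal.ofReal (x k) ≤ 1 := ENNReal.le_one_of_rpow_le_one hp h1
    rw [ENNReal.ofReal_pow (hx0 k), ← ENNReal.rpow_natCast]
    exact ENNReal.rpow_le_rpow_of_exponent_ge h2 (by exact_mod_cast hp2)
  have hxs : Summable fun k => x k ^ 2 := by
    have h1 := ENNReal.summable_toReal (ne_top_of_le_ne_top ENNReal.one_ne_top hx2)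
    exact h1.congr fun k => by rw [ENNReal.toReal_ofReal (by positivity)]
  have hxt : ∑' k, x k ^ 2 ≤ 1 := by
    rw [← ENNReal.ofReal_tsum_of_nonneg (fun k => by positivity) hxs] at hx2
    exact ENNReal.ofReal_le_one.1 hx2
  set y : ℕ → ℝ := fun k => ‖kernelCoeff β b ζ k‖ * (1 + 1 / (4 * M)) ^ k with hy
  have hM0 : 0 < M := by linarith
  have hy0 : ∀ k, 0 ≤ y k := fun k => by positivity
  have hg : HasSum (fun k => a k * kernelCoeff β b ζ k) (fζ - b * H) := by
    refine (hf.sub (hH.mul_left b)).congr_fun fun k => ?_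
    rw [kernelCoeff]
    ring
  have hterm : ∀ k, ‖a k * kernelCoeff β b ζ k‖ ≤ D * (x k * y k) := by
    intro k
    have hk : (0 : ℝ) < ((k : ℝ) + 1) ^ s := by positivity
    have h1 : ‖a k‖ = x k * ((k : ℝ) + 1) ^ s := by
      rw [hx, mul_assoc, ← Real.rpow_add (by positivity), neg_add_cancel, Real.rpow_zero, mul_one]
    rw [norm_mul, h1]
    calc x k * ((k : ℝ) + 1) ^ s * ‖kernelCoeff β b ζ k‖
        ≤ x k * (D * (1 + 1 / (4 * M)) ^ k) * ‖kernelCoeff β b ζ k‖ := by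
          gcongr
          exact rpow_le_mul_pow hs hM k
      _ = D * (x k * y k) := by rw [hy]; ring
  obtain ⟨hsum, hle⟩ := Real.summable_and_inner_le_Lp_mul_Lq_tsum_of_nonneg
    (Real.HolderConjugate.two_two) hx0 hy0
    (by simpa only [Real.rpow_two] using hxs) (by simpa only [Real.rpow_two] using hT.summable)
  have hyT : ∑' k, y k ^ 2 = T := hT.tsum_eq
  simp only [Real.rpow_two, ← Real.sqrt_eq_rpow, hyT] at hle
  rw [← hg.tsum_eq]
  refine (tsum_of_norm_bounded (hsum.hasSum.mul_left D) hterm).trans ?_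
  refine mul_le_mul_of_nonneg_left (hle.trans ?_) hD0
  calc √(∑' k, x k ^ 2) * √T ≤ 1 * √T := by
        gcongr
        exact Real.sqrt_le_one.2 hxt
    _ = √T := one_mul _

/-- The interpolant `f - B_σ T f`, with `T` the Toeplitz operator of symbol conjugate to `B_σ`. -/
theorem exists_interpolant {p α : ℝ} (hp : p ∈ Set.Icc (1 : ℝ) 2) (hα : α ≤ 0) {n : ℕ} (hn : 1 ≤ n)
    {r : ℝ} (hr0 : 0 ≤ r) (hr : r < 1) {σ : Multiset ℂ} (hcard : σ.card ≤ n)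
    (hσ : ∀ a ∈ σ, ‖a‖ ≤ r) {f : ℂ → ℂ} (hfd : DifferentiableOn ℂ f disc)
    (hf1 : laNorm p α f ≤ 1) :
    ∃ g : ℂ → ℂ, DifferentiableOn ℂ g disc ∧ g - f ∈ blaschkeMul σ (holSpace (laNorm p α)) ∧
      ∀ z, ‖z‖ < 1 → ‖g z‖ ≤ 2 * (1 + Real.exp 1 * Real.exp 1) * (8 * (-α + 1)) ^ (-α) *
        ((n : ℝ) / (1 - r)) ^ ((1 - 2 * α) / 2) := by
  have hp0 : 0 < p := by linarith [hp.1]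
  set s := -α with hs
  have hs0 : 0 ≤ s := by linarith
  have hn1 : (1 : ℝ) ≤ n := by exact_mod_cast hn
  have h1r : 0 < 1 - r := by linarith
  set M := (n : ℝ) / (1 - r) with hM
  have hM1 : 1 ≤ M := by rw [hM, one_le_div h1r]; linarith
  have hM0 : 0 < M := by linarith
  set δ := 1 / (4 * M) with hδ
  have hδ0 : 0 < δ := by positivity
  have hδr : δ = (1 - r) / (4 * n) := by rw [hδ, hM]; field_simp
  have hδr' : 4 * δ ≤ 1 - r := by
    have : δ * (4 * n) = 1 - r := by rw [hδr]; field_simp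
    nlinarith
  have hσ' : ∀ a ∈ σ.map (starRingEnd ℂ), ‖a‖ ≤ r := by
    intro a ha
    obtain ⟨c, hc, rfl⟩ := Multiset.mem_map.1 ha
    rw [RCLike.norm_conj]
    exact hσ c hc
  set Bs := blaschke (σ.map (starRingEnd ℂ)) with hBs
  set β := taylorCoeff Bs with hβ
  have hBsum : ∀ w, ‖w‖ ≤ 1 + 2 * δ → HasSum (fun k => β k * w ^ k) (Bs w) := fun w hw =>
    hasSum_taylorCoeff_blaschke hr0 hr hσ' (by nlinarith [mul_le_mul_of_nonneg_left hw hr0])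
  have hβs : Summable fun j => ‖β j‖ * ((j : ℝ) + 1) ^ s := by
    have h1 := (hBsum ((1 + δ : ℝ) : ℂ) (by
      rw [Complex.norm_of_nonneg (by linarith)]; linarith)).summable.norm
    refine Summable.of_nonneg_of_le (fun j => by positivity) (fun j => ?_)
      (h1.mul_left ((8 * (s + 1)) ^ s * M ^ s))
    rw [norm_mul, norm_pow, Complex.norm_of_nonneg (by linarith)]
    calc ‖β j‖ * ((j : ℝ) + 1) ^ s
        ≤ ‖β j‖ * ((8 * (s + 1)) ^ s * M ^ s * (1 + δ) ^ j) := by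
          gcongr
          exact rpow_le_mul_pow hs0 hM1 j
      _ = _ := by ring
  set a := taylorCoeff f with ha
  have haX : ∑' k : ℕ, ENNReal.ofReal (‖a k‖ * ((k : ℝ) + 1) ^ α) ^ p ≤ 1 := by
    rw [laNorm_eq hp0] at hf1
    exact ENNReal.le_one_of_rpow_le_one (by positivity) hf1
  have hak : ∀ k, ‖a k‖ ≤ ((k : ℝ) + 1) ^ s := by
    intro k
    have h1 := ENNReal.le_one_of_rpow_le_one hp0 ((ENNReal.le_tsum k).trans haX)
    rw [ENNReal.ofReal_le_one] at h1
    rw [hs, Real.rpow_neg (by positivity), ← one_div, le_div_iff₀ (by positivity)]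
    exact h1
  set h : ℂ → ℂ := fun z => ∑' m, -toeplitzCoeff β a m * z ^ m with hh
  have hH : ∀ z, ‖z‖ < 1 → HasSum (fun m => -toeplitzCoeff β a m * z ^ m) (h z) ∧
      HasSum (fun k => a k * ∑ j ∈ Finset.range (k + 1), β j * z ^ (k - j)) (-h z) := by
    intro z hz
    obtain ⟨H, h1, h2⟩ := exists_hasSum_toeplitzCoeff hs0 hβs hak hz
    have h3 : HasSum (fun m => -toeplitzCoeff β a m * z ^ m) (-H) := by
      simpa only [neg_mul] using h1.neg
    have h4 : h z = -H := h3.tsum_eq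
    rw [h4, neg_neg]
    exact ⟨h3, h2⟩
  have hhd : DifferentiableOn ℂ h disc := differentiableOn_disc_of_hasSum fun z hz => (hH z hz).1
  have hhX : laNorm p α h < ∞ := by
    rw [laNorm_eq hp0]
    refine ENNReal.rpow_lt_top_of_nonneg (by positivity) (ne_of_lt ?_)
    simp_rw [taylorCoeff_of_hasSum fun z hz => (hH z hz).1, norm_neg]
    exact tsum_toeplitzCoeff_lt_top hp.1 hα hβs (haX.trans_lt ENNReal.one_lt_top)
  have hBd : DifferentiableOn ℂ (blaschke σ) disc := fun z hz =>
    (differentiableAt_blaschke (by nlinarith [mem_disc.1 hz, norm_nonneg z])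
      σ hσ).differentiableWithinAt
  set g : ℂ → ℂ := fun z => f z + blaschke σ z * h z with hg
  have hgd : DifferentiableOn ℂ g disc := hfd.add (hBd.mul hhd)
  refine ⟨g, hgd, ⟨h, ⟨hhd, hhX⟩, fun z _ => by simp [hg]⟩, ?_⟩
  set A := 2 * (1 + Real.exp 1 * Real.exp 1) * (8 * (s + 1)) ^ s * M ^ ((1 - 2 * α) / 2) with hA
  have hring : ∀ ζ, ‖ζ‖ < 1 → 1 ≤ (1 + δ) * ‖ζ‖ ^ 2 → ‖g ζ‖ ≤ A := by
    intro ζ hζ1 hζ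
    have hζn : 0 < ‖ζ‖ := by
      by_contra hcon
      have : ‖ζ‖ = 0 := le_antisymm (not_lt.1 hcon) (norm_nonneg ζ)
      rw [this] at hζ
      norm_num at hζ
    have hρζ : 1 < (1 + δ) * ‖ζ‖ := by nlinarith
    have hrζ : r < ‖ζ‖ := by nlinarith
    have hb := blaschke_mul_blaschke_inv hrζ (by nlinarith) σ hσ
    have hbn : ‖blaschke σ ζ‖ ≤ Real.exp 1 :=
      norm_blaschke_le hn hr hcard hσ (by rw [← hδr]; linarith)
    have hK : ∀ w, ‖w‖ = 1 + δ → ‖1 - blaschke σ ζ * Bs w‖ ≤ 1 + Real.exp 1 * Real.exp 1 := by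
      intro w hw
      have h1 : ‖Bs w‖ ≤ Real.exp 1 :=
        norm_blaschke_le hn hr (by rwa [Multiset.card_map]) hσ' (by rw [← hδr, hw])
      refine (norm_sub_le _ _).trans ?_
      rw [norm_one, norm_mul]
      gcongr
    obtain ⟨T, hT, hTs⟩ := exists_hasSum_norm_sq_kernelCoeff (by linarith)
      (show 1 + δ < 1 + 2 * δ by linarith) hρζ hBsum hb hK
    have h1 := norm_toeplitz_interpolant_le hs0 hp0 hp.2 (by simpa [hs] using haX) hM1
      (hasSum_taylorCoeff hfd hζ1) (hH ζ hζ1).2 hTs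
    have h2 : ‖g ζ‖ = ‖f ζ - blaschke σ ζ * -h ζ‖ := by simp [hg]
    rw [h2]
    refine h1.trans ?_
    -- `ρ²|ζ|² - 1 ≥ δ = 1 / (4M)` turns the kernel estimate into a multiple of `M`
    have h3 : √T ≤ 2 * (1 + Real.exp 1 * Real.exp 1) * M ^ (1 / 2 : ℝ) := by
      rw [← Real.sqrt_eq_rpow]
      refine Real.sqrt_le_iff.2 ⟨by positivity, hT.trans ?_⟩
      rw [mul_pow _ (√M), Real.sq_sqrt hM0.le]
      have h4 : ((1 + δ) * ‖ζ‖) ^ 2 - 1 ≥ δ := by nlinarith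
      calc (1 + Real.exp 1 * Real.exp 1) ^ 2 * (((1 + δ) * ‖ζ‖) ^ 2 - 1)⁻¹
          ≤ (1 + Real.exp 1 * Real.exp 1) ^ 2 * δ⁻¹ := by gcongr
        _ = _ := by rw [hδ]; field_simp; ring
    calc (8 * (s + 1)) ^ s * M ^ s * √T
        ≤ (8 * (s + 1)) ^ s * M ^ s * (2 * (1 + Real.exp 1 * Real.exp 1) * M ^ (1 / 2 : ℝ)) := by
          gcongr
      _ = A := by
          rw [hA, show (1 - 2 * α) / 2 = s + 1 / 2 by rw [hs]; ring, Real.rpow_add hM0]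
          ring
  intro z hz
  -- the maximum principle on a disc of radius close to one
  obtain ⟨t, ht1, ht2, ht3⟩ : ∃ t : ℝ, ‖z‖ < t ∧ t < 1 ∧ 1 ≤ (1 + δ) * t ^ 2 := by
    have h1 : √(1 / (1 + δ)) < 1 := by
      rw [Real.sqrt_lt' one_pos, one_pow, div_lt_one (by linarith)]
      linarith
    obtain ⟨t, h2, h3⟩ := exists_between (max_lt hz h1)
    refine ⟨t, (le_max_left _ _).trans_lt h2, h3, ?_⟩
    have h4 : 1 / (1 + δ) ≤ t ^ 2 :=
      Real.sqrt_le_left (le_of_lt ((norm_nonneg z).trans_lt ((le_max_left _ _).trans_lt h2))) |>.1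
        ((le_max_right _ _).trans h2.le)
    rwa [div_le_iff₀' (by linarith)] at h4
  have ht0 : 0 < t := (norm_nonneg z).trans_lt ht1
  refine Complex.norm_le_of_forall_mem_frontier_norm_le (U := Metric.ball 0 t)
    Metric.isBounded_ball ?_ (fun w hw => ?_) (subset_closure (by simpa using ht1))
  · refine DifferentiableOn.diffContOnCl (hgd.mono fun w hw => ?_)
    rw [closure_ball _ ht0.ne'] at hw
    exact mem_disc.2 (lt_of_le_of_lt (by simpa using hw) ht2)
  · rw [frontier_ball _ ht0.ne'] at hw
    have hw' : ‖w‖ = t := by simpa using hw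
    exact hring w (by rwa [hw']) (by rwa [hw'])

theorem theoremC (p α : ℝ) (hp : p ∈ Set.Icc (1 : ℝ) 2) (hα : α ≤ 0) :
    ∃ A B : ℝ, 0 < A ∧ 0 < B ∧
      ∀ (n : ℕ) (r : ℝ), 1 ≤ n → 0 ≤ r → r < 1 →
        ENNReal.ofReal (B * (n : ℝ) ^ (1 - α - 1 / p))
            ≤ interpConstSup n r (laNorm p α) supNorm ∧
          interpConstSup n r (laNorm p α) supNorm
            ≤ ENNReal.ofReal (A * ((n : ℝ) / (1 - r)) ^ ((1 - 2 * α) / 2)) := by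
  have hα1 : 0 < -α + 1 := by linarith
  refine ⟨2 * (1 + Real.exp 1 * Real.exp 1) * (8 * (-α + 1)) ^ (-α), 2 ^ α / 8, by positivity,
    by positivity, fun n r hn hr0 hr => ⟨le_interpConstSup hp.1 hα hn hr0, ?_⟩⟩
  refine iSup₂_le fun σ hσ => iSup₂_le fun f hf => ?_
  obtain ⟨g, hgd, hgf, hgb⟩ := exists_interpolant hp hα hn hr0 hr hσ.1 hσ.2 hf.1.1 hf.2
  have hsup : supNorm g ≤ ENNReal.ofReal (2 * (1 + Real.exp 1 * Real.exp 1) *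
      (8 * (-α + 1)) ^ (-α) * ((n : ℝ) / (1 - r)) ^ ((1 - 2 * α) / 2)) := by
    refine iSup₂_le fun z hz => ?_
    rw [← ofReal_norm]
    exact ENNReal.ofReal_le_ofReal (hgb z (mem_disc.1 hz))
  exact iInf₂_le_of_le g ⟨⟨hgd, hsup.trans_lt ENNReal.ofReal_lt_top⟩, hgf⟩ hsup
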